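/- A group $\Gamma$ is called polycyclic if there is a finite chain of subgroups $\Gamma=\Gamma_0\supseteq\Gamma_1\supseteq\dots\supseteq\Gamma_n=\{1\}$ such that $\Gamma_{i+1}$ is normal in $\Gamma_i$ and $\Gamma_i/\Gamma_{i+1}$ is cyclic for every $0\le i<n$. Lemma. Let $G$ be a (finite-dimensional, real, not necessarily connected) Lie group and $\Gamma$ a dense polycyclic subgroup of $G$. Let $\operatorname{Aut}(G)$ be the group of smooth automorphisms of $G$ with smooth inverse, and $\operatorname{Aut}(G,\Gamma)=\{a\in\operatorname{Aut}(G)\mid a(\Gamma)=\Gamma\}$. Let $\operatorname{Lie}(G)$ be the real Lie algebra of right invariant vector fields on $G$ and let $\rho\colon\operatorname{Aut}(G,\Gamma)\to\operatorname{Aut}(\operatorname{Lie}(G))$ be defined by $\rho(a)=Da$, where $Da$ is the restriction of the tangent map of $a\colon G\to G$ to right invariant vector fields, that is, $(Da\,X)(a(g))=(da)_g(X(g))$ for all $g\in G$. Then for every $a\in\operatorname{Aut}(G,\Gamma)$, every (complex) eigenvalue of $Da$, i.e. every eigenvalue of the complexification of $Da$ on $\mathbb{C}\otimes_{\mathbb{R}}\operatorname{Lie}(G)$,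 is an algebraic integer. -/

import Mathlib

open scoped Manifold ContDiff

/-- A group `Γ` is polycyclic if it has a finite chain of subgroups
`Γ = S 0 ⊵ S 1 ⊵ ⋯ ⊵ S n = 1` with every quotient `S i / S (i + 1)` cyclic. -/
def IsPolycyclic (Γ : Type*) [Group Γ] : Prop :=
  ∃ (n : ℕ) (S : ℕ → Subgroup Γ), S 0 = ⊤ ∧ S n = ⊥ ∧
    ∀ i < n, S (i + 1) ≤ S i ∧
      ∃ _ : ((S (i + 1)).subgroupOf (S i)).Normal, IsCyclic (S i ⧸ (S (i + 1)).subgroupOf (S i))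

namespace LieGroupAut

variable {E : Type*} [NormedAddCommGroup E] [NormedSpace ℝ E] {H : Type*} [TopologicalSpace H]
  (I : ModelWithCorners ℝ E H) (G : Type*) [TopologicalSpace G] [ChartedSpace H G] [Group G]

/-- The group `Aut(G)` of automorphisms of the Lie group `G`: the group automorphisms that are
smooth together with their inverse. -/
def lieAut : Subgroup (MulAut G) where
  carrier := {a | ContMDiff I I ∞ (fun g => a g) ∧ ContMDiff I I ∞ (fun g => a⁻¹ g)}
  one_mem' := ⟨contMDiff_id, contMDiff_id⟩
  mul_mem' := by
    rintro a b ⟨ha, ha'⟩ ⟨hb, hb'⟩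
    refine ⟨ha.comp hb, ?_⟩
    rw [mul_inv_rev]
    exact hb'.comp ha'
  inv_mem' := by
    rintro a ⟨ha, ha'⟩
    exact ⟨ha', by rwa [inv_inv]⟩

variable {G} in
/-- The group `Aut(G, Γ) = {a ∈ Aut(G) | a(Γ) = Γ}`. -/
def lieAutPair (Γ : Subgroup G) : Subgroup (MulAut G) where
  carrier := {a | a ∈ lieAut I G ∧ Γ.map a.toMonoidHom = Γ}
  one_mem' := ⟨one_mem _, Γ.map_id⟩
  mul_mem' := by
    rintro a b ⟨ha, ha'⟩ ⟨hb, hb'⟩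
    refine ⟨mul_mem ha hb, ?_⟩
    have : Γ.map (a * b).toMonoidHom = (Γ.map b.toMonoidHom).map a.toMonoidHom :=
      (Subgroup.map_map Γ a.toMonoidHom b.toMonoidHom).symm
    rw [this, hb', ha']
  inv_mem' := by
    rintro a ⟨ha, ha'⟩
    refine ⟨inv_mem ha, ?_⟩
    conv_lhs => rw [← ha', Subgroup.map_map]
    convert Γ.map_id
    ext g
    exact a.symm_apply_apply g

variable {I G}

/-- An element of `Aut(G)` as a diffeomorphism of `G`. -/
def toDiffeo {a : MulAut G} (ha : a ∈ lieAut I G) : G ≃ₘ^∞⟮I, I⟯ G where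
  toEquiv := a.toEquiv
  contMDiff_toFun := ha.1
  contMDiff_invFun := ha.2

/-- A vector field `X` on `G` is right invariant if `d(R_h)_g (X g) = X (g h)` for all `g`, `h`,
where `R_h` is the right translation by `h`. -/
def IsRightInvariant (X : Π g : G, TangentSpace I g) : Prop :=
  ∀ g h : G, mfderiv I I (fun x => x * h) g (X g) = X (g * h)

/-- The pullback of vector fields by a diffeomorphism, described without inverting derivatives. -/
theorem mpullback_eq_iff {G : Type*} [TopologicalSpace G] [ChartedSpace H G] (Φ : G ≃ₘ^∞⟮I, I⟯ G) (X Y : Π g : G, TangentSpace I g) :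
    VectorField.mpullback I I Φ X = Y ↔ ∀ g, mfderiv I I Φ g (Y g) = X (Φ g) := by
  have key : ∀ g, VectorField.mpullback I I Φ X g = Y g ↔
      mfderiv I I Φ g (Y g) = X (Φ g) := by
    intro g
    have e := Diffeomorph.mfderivToContinuousLinearEquiv_coe (x := g) Φ (by simp)
    rw [VectorField.mpullback_apply, ← e, ContinuousLinearMap.inverse_equiv]
    exact (Φ.mfderivToContinuousLinearEquiv (by simp) g).symm_apply_eq.trans eq_comm
  rw [funext_iff]
  exact forall_congr' key

theorem mpullback_symm_eq_iff {G : Type*} [TopologicalSpace G] [ChartedSpace H G]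
    (Φ : G ≃ₘ^∞⟮I, I⟯ G) (X Y : Π g : G, TangentSpace I g) :
    VectorField.mpullback I I Φ.symm X = Y ↔ ∀ g, mfderiv I I Φ g (X g) = Y (Φ g) := by
  have key : ∀ (Ψ : G ≃ₘ^∞⟮I, I⟯ G) (X Y : Π g : G, TangentSpace I g),
      VectorField.mpullback I I Ψ.symm X = Y → VectorField.mpullback I I Ψ Y = X := by
    intro Ψ X Y h
    rw [mpullback_eq_iff] at h ⊢
    intro g
    apply (Ψ.symm.mfderivToContinuousLinearEquiv (x := Ψ g) (by simp)).injective
    have h1 : mfderiv I I (Ψ.symm ∘ Ψ) g =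
        (mfderiv I I Ψ.symm (Ψ g)).comp (mfderiv I I Ψ g) :=
      mfderiv_comp g (Ψ.symm.mdifferentiable (by simp) _) (Ψ.mdifferentiable (by simp) _)
    have h2 : (Ψ.symm ∘ Ψ : G → G) = id := funext Ψ.symm_apply_apply
    rw [h2, mfderiv_id] at h1
    have h3 : (X (Ψ.symm (Ψ g)) : E) = X g :=
      congrArg (fun x => (X x : E)) (Ψ.symm_apply_apply g)
    exact (DFunLike.congr_fun h1 (X g)).symm.trans (h3.symm.trans (h (Ψ g)).symm)
  rw [← mpullback_eq_iff]
  exact ⟨key Φ X Y, key Φ.symm Y X⟩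

variable (I) in
/-- Right translation as a diffeomorphism. -/
def rightTranslation [LieGroup I ∞ G] (h : G) : G ≃ₘ^∞⟮I, I⟯ G where
  toEquiv := Equiv.mulRight h
  contMDiff_toFun := contMDiff_mul_right
  contMDiff_invFun := contMDiff_mul_right

theorem isRightInvariant_iff [LieGroup I ∞ G] (X : Π g : G, TangentSpace I g) :
    IsRightInvariant X ↔ ∀ h, VectorField.mpullback I I (rightTranslation I h) X = X := by
  simp only [mpullback_eq_iff]
  exact forall_comm

variable (I G) in
/-- The vector space `Lie(G)` of (smooth) right invariant vector fields on `G`. -/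
def rightInvariantFields [LieGroup I ∞ G] : Submodule ℝ (Π g : G, TangentSpace I g) where
  carrier := {X | ContMDiff I I.tangent ∞ (fun g => (⟨g, X g⟩ : TangentBundle I G)) ∧
    IsRightInvariant X}
  zero_mem' := ⟨Bundle.contMDiff_zeroSection ℝ (TangentSpace I : G → Type _),
    fun g h => map_zero (mfderiv I I (fun x => x * h) g)⟩
  add_mem' := by
    rintro X Y ⟨hX, hX'⟩ ⟨hY, hY'⟩
    refine ⟨hX.add_section hY, fun g h => ?_⟩
    exact (map_add (mfderiv I I (fun x => x * h) g) (X g) (Y g)).trans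
      (congrArg₂ _ (hX' g h) (hY' g h))
  smul_mem' := by
    rintro c X ⟨hX, hX'⟩
    refine ⟨hX.const_smul_section, fun g h => ?_⟩
    exact (map_smul (mfderiv I I (fun x => x * h) g) c (X g)).trans (congrArg _ (hX' g h))

section Bracket

variable [LieGroup I ∞ G]

theorem mdifferentiableAt_field (X : rightInvariantFields I G) (g : G) :
    MDifferentiableAt I I.tangent (fun g => (⟨g, X.1 g⟩ : TangentBundle I G)) g :=
  (X.2.1 g).mdifferentiableAt (by simp)

variable [FiniteDimensional ℝ E]

theorem contMDiff_mlieBracket {X Y : Π g : G, TangentSpace I g}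
    (hX : ContMDiff I I.tangent ∞ (fun g => (⟨g, X g⟩ : TangentBundle I G)))
    (hY : ContMDiff I I.tangent ∞ (fun g => (⟨g, Y g⟩ : TangentBundle I G))) :
    ContMDiff I I.tangent ∞
      (fun g => (⟨g, VectorField.mlieBracket I X Y g⟩ : TangentBundle I G)) := by
  have : IsManifold I ((⊤ : ℕ∞) + 1) G := inferInstanceAs (IsManifold I ∞ G)
  have : IsManifold I (minSmoothness ℝ 2) G := by
    rw [minSmoothness_of_isRCLikeNormedField]; infer_instance
  have := FiniteDimensional.complete ℝ E
  exact ContDiff.mlieBracket_vectorField (n := ⊤) (m := ⊤) hX hY (by simp)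

/-- The Lie bracket of vector fields is natural with respect to diffeomorphisms. -/
theorem mpullback_bracket (Φ : G ≃ₘ^∞⟮I, I⟯ G) (X Y : rightInvariantFields I G) :
    VectorField.mpullback I I Φ (VectorField.mlieBracket I X.1 Y.1) =
      VectorField.mlieBracket I (VectorField.mpullback I I Φ X.1)
        (VectorField.mpullback I I Φ Y.1) := by
  have : IsManifold I (minSmoothness ℝ 2) G := by
    rw [minSmoothness_of_isRCLikeNormedField]; infer_instance
  have := FiniteDimensional.complete ℝ E
  funext g
  exact VectorField.mpullback_mlieBracket (n := 2) (mdifferentiableAt_field X _)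
    (mdifferentiableAt_field Y _) ((Φ.contMDiff g).of_le ENat.LEInfty.out)
    (by rw [minSmoothness_of_isRCLikeNormedField])

/-- The Lie bracket on `Lie(G)` is the Lie bracket of vector fields. -/
noncomputable instance : Bracket (rightInvariantFields I G) (rightInvariantFields I G) where
  bracket X Y := ⟨VectorField.mlieBracket I X.1 Y.1, contMDiff_mlieBracket X.2.1 Y.2.1, by
    rw [isRightInvariant_iff]
    intro h
    rw [mpullback_bracket, (isRightInvariant_iff _).1 X.2.2, (isRightInvariant_iff _).1 Y.2.2]⟩

theorem bracket_coe (X Y : rightInvariantFields I G) :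
    (⁅X, Y⁆ : rightInvariantFields I G).1 = VectorField.mlieBracket I X.1 Y.1 := rfl

noncomputable instance : LieRing (rightInvariantFields I G) where
  add_lie X Y Z := Subtype.ext <| funext fun g => VectorField.mlieBracket_add_left
    (mdifferentiableAt_field X g) (mdifferentiableAt_field Y g)
  lie_add X Y Z := Subtype.ext <| funext fun g => VectorField.mlieBracket_add_right
    (mdifferentiableAt_field Y g) (mdifferentiableAt_field Z g)
  lie_self X := Subtype.ext (by rw [bracket_coe]; simp)
  leibniz_lie X Y Z := by
    have : IsManifold I (minSmoothness ℝ 3) G := by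
      rw [minSmoothness_of_isRCLikeNormedField]; infer_instance
    have := FiniteDimensional.complete ℝ E
    have h2 : minSmoothness ℝ 2 ≤ ∞ := by
      rw [minSmoothness_of_isRCLikeNormedField]; exact ENat.LEInfty.out
    exact Subtype.ext <| VectorField.leibniz_identity_mlieBracket
      (X.2.1.of_le h2) (Y.2.1.of_le h2) (Z.2.1.of_le h2)

noncomputable instance : LieAlgebra ℝ (rightInvariantFields I G) where
  lie_smul _ _ Y := by
    have := FiniteDimensional.complete ℝ E
    exact Subtype.ext <| funext fun g => VectorField.mlieBracket_const_smul_right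
      (mdifferentiableAt_field Y g)

/-- The push-forward `a_* X` of a right invariant vector field by an automorphism `a` of `G`,
i.e. its pullback by the inverse of `a`. -/
noncomputable def pushforward {a : MulAut G} (ha : a ∈ lieAut I G)
    (X : rightInvariantFields I G) : rightInvariantFields I G :=
  ⟨VectorField.mpullback I I (toDiffeo ha).symm X.1, by
    have := FiniteDimensional.complete ℝ E
    refine ⟨X.2.1.mpullback_vectorField (n := ∞) (toDiffeo ha).symm.contMDiff
      (fun g => ⟨_, Diffeomorph.mfderivToContinuousLinearEquiv_coe _ (by simp)⟩) (by simp), ?_⟩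
    have hY := (mpullback_symm_eq_iff (toDiffeo ha) X.1 _).1 rfl
    set Y := VectorField.mpullback I I (toDiffeo ha).symm X.1
    intro g h
    obtain ⟨x, rfl⟩ := (toDiffeo ha).surjective g
    obtain ⟨k, rfl⟩ := (toDiffeo ha).surjective h
    have hd (Ψ Φ : G ≃ₘ^∞⟮I, I⟯ G) (g : G) : mfderiv I I (Ψ ∘ Φ) g =
        (mfderiv I I Ψ (Φ g)).comp (mfderiv I I Φ g) :=
      mfderiv_comp g (Ψ.mdifferentiable (by simp) _) (Φ.mdifferentiable (by simp) _)
    have h1 := hd (rightTranslation I (toDiffeo ha k)) (toDiffeo ha) x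
    have h2 := hd (toDiffeo ha) (rightTranslation I k) x
    have h3 : (rightTranslation I (toDiffeo ha k) ∘ toDiffeo ha : G → G) =
        toDiffeo ha ∘ rightTranslation I k := funext fun y => (map_mul a y k).symm
    have h4 : (mfderiv I I (rightTranslation I (toDiffeo ha k)) (toDiffeo ha x)).comp
        (mfderiv I I (toDiffeo ha) x) = (mfderiv I I (toDiffeo ha)
          (rightTranslation I k x)).comp (mfderiv I I (rightTranslation I k) x) := by
      rw [← h1, ← h2, h3]
    have h5 : (Y (toDiffeo ha (x * k)) : E) = Y (toDiffeo ha x * toDiffeo ha k) :=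
      congrArg (fun y => (Y y : E)) (map_mul a x k)
    refine (congrArg (mfderiv I I (rightTranslation I (toDiffeo ha k)) (toDiffeo ha x))
      (hY x)).symm.trans ?_
    refine (DFunLike.congr_fun h4 (X.1 x)).trans (Eq.trans ?_ h5)
    exact (congrArg (mfderiv I I (toDiffeo ha) (x * k)) (X.2.2 x k)).trans (hY (x * k))⟩

/-- The push-forward is given by the tangent map of `a`: `(a_* X) (a g) = (da)_g (X g)`. -/
theorem pushforward_eq_iff {a : MulAut G} (ha : a ∈ lieAut I G)
    (X Y : rightInvariantFields I G) :
    pushforward ha X = Y ↔ ∀ g, mfderiv I I (fun x => a x) g (X.1 g) = Y.1 (a g) :=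
  Subtype.ext_iff.trans (mpullback_symm_eq_iff (toDiffeo ha) X.1 Y.1)

/-- The automorphism `Da` of the Lie algebra `Lie(G)` of right invariant vector fields induced by
the tangent map of an automorphism `a` of `G`. -/
noncomputable def differential {a : MulAut G} (ha : a ∈ lieAut I G) :
    rightInvariantFields I G ≃ₗ⁅ℝ⁆ rightInvariantFields I G where
  toFun := pushforward ha
  map_add' _ _ := Subtype.ext VectorField.mpullback_add
  map_smul' _ _ := Subtype.ext VectorField.mpullback_const_smul
  map_lie' {X Y} := Subtype.ext (mpullback_bracket _ X Y)
  invFun := pushforward (inv_mem ha)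
  left_inv X := Subtype.ext <|
    (mpullback_eq_iff (toDiffeo ha) _ X.1).2 ((pushforward_eq_iff ha X _).1 rfl)
  right_inv X := Subtype.ext <|
    (mpullback_eq_iff (toDiffeo ha).symm _ X.1).2 ((pushforward_eq_iff (inv_mem ha) X _).1 rfl)

/-- The map `ρ : Aut(G, Γ) → Aut(Lie(G))`, `ρ(a) = Da`. -/
noncomputable def rho (Γ : Subgroup G) (a : lieAutPair I Γ) :
    rightInvariantFields I G ≃ₗ⁅ℝ⁆ rightInvariantFields I G :=
  differential a.2.1

end Bracket

end LieGroupAut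

open Polynomial

section Group

variable {G : Type*} [Group G]

theorem Subgroup.FG.subgroupMap {G' : Type*} [Group G'] {K : Subgroup G} (h : K.FG)
    (f : G →* G') : (K.map f).FG := by
  classical
  obtain ⟨s, rfl⟩ := h
  exact ⟨s.image f, by rw [MonoidHom.map_closure, Finset.coe_image]⟩

theorem Subgroup.fg_of_inf_fg_of_isCyclic {S T K : Subgroup G} (hK : K ≤ S)
    [(T.subgroupOf S).Normal] [IsCyclic (S ⧸ T.subgroupOf S)] (hfg : (K ⊓ T).FG) : K.FG := by
  let π := QuotientGroup.mk' (T.subgroupOf S)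
  obtain ⟨z, hz⟩ := (Subgroup.isCyclic_iff_exists_zpowers_eq_top
    ((K.subgroupOf S).map π)).1 inferInstance
  obtain ⟨k, hk, rfl⟩ : z ∈ (K.subgroupOf S).map π := hz ▸ Subgroup.mem_zpowers z
  have hk' : (k : G) ∈ K := hk
  have : K = (K ⊓ T) ⊔ Subgroup.zpowers (k : G) := by
    refine le_antisymm (fun x hx => ?_) (sup_le inf_le_left (by simpa using hk'))
    have hx' : π ⟨x, hK hx⟩ ∈ Subgroup.zpowers (π k) :=
      hz ▸ Subgroup.mem_map_of_mem π (show (⟨x, hK hx⟩ : S) ∈ K.subgroupOf S from hx)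
    obtain ⟨m, hm⟩ := Subgroup.mem_zpowers_iff.1 hx'
    rw [← map_zpow, ← inv_mul_eq_one, ← map_inv, ← map_mul] at hm
    have h1 : ((k ^ m)⁻¹ * ⟨x, hK hx⟩ : S) ∈ T.subgroupOf S :=
      (QuotientGroup.eq_one_iff _).1 hm
    have h2 : ((k : G) ^ m)⁻¹ * x ∈ T := by simpa [Subgroup.mem_subgroupOf] using h1
    have h3 : ((k : G) ^ m)⁻¹ * x ∈ K := K.mul_mem (K.inv_mem (K.zpow_mem hk' m)) hx
    have h4 : x = (k : G) ^ m * (((k : G) ^ m)⁻¹ * x) := by group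
    rw [h4]
    exact Subgroup.mul_mem _ (le_sup_right (a := K ⊓ T) (Subgroup.zpow_mem_zpowers _ m))
      (le_sup_left (a := K ⊓ T) ⟨h3, h2⟩)
  rw [this]
  exact hfg.sup ⟨{(k : G)}, by simp [Subgroup.zpowers_eq_closure]⟩

theorem Subgroup.commutator_le_of_isMulCommutative_quotient {S T : Subgroup G}
    [(T.subgroupOf S).Normal] (h : ∀ x y : S ⧸ T.subgroupOf S, x * y = y * x) : ⁅S, S⁆ ≤ T := by
  rw [Subgroup.commutator_le]
  intro x hx y hy
  let s : S := ⟨x, hx⟩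
  let t : S := ⟨y, hy⟩
  have h1 : (QuotientGroup.mk' (T.subgroupOf S)) (s * t * s⁻¹ * t⁻¹) = 1 := by
    simp only [map_mul, map_inv]
    rw [h (QuotientGroup.mk' _ s), mul_inv_cancel_right, mul_inv_cancel]
  exact (QuotientGroup.eq_one_iff (N := T.subgroupOf S) _).1 h1

/-- Every subgroup of a polycyclic group is finitely generated. -/
theorem IsPolycyclic.subgroup_fg (h : IsPolycyclic G) (K : Subgroup G) : K.FG := by
  obtain ⟨n, S, h0, hn, hS⟩ := h
  have key : ∀ i ≤ n, ∀ K : Subgroup G, K ≤ S i → K.FG := by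
    intro i hi
    induction hi using Nat.decreasingInduction with
    | self => exact fun K hK => (le_bot_iff.1 (hn ▸ hK)) ▸ ⟨∅, by simp⟩
    | of_succ i hi ih =>
      intro K hK
      obtain ⟨-, _, _⟩ := hS i hi
      exact Subgroup.fg_of_inf_fg_of_isCyclic (T := S (i + 1)) hK (ih _ inf_le_right)
  exact key 0 n.zero_le K (h0 ▸ le_top)

/-- A polycyclic group is solvable. -/
theorem IsPolycyclic.isSolvable (h : IsPolycyclic G) : Group.IsSolvable G := by
  obtain ⟨n, S, h0, hn, hS⟩ := h
  have key : ∀ i ≤ n, derivedSeries G i ≤ S i := by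
    intro i
    induction i with
    | zero => exact fun _ => h0 ▸ le_top
    | succ i ih =>
      intro hi
      obtain ⟨-, _, _⟩ := hS i hi
      exact (Subgroup.commutator_mono (ih (by omega)) (ih (by omega))).trans
        (Subgroup.commutator_le_of_isMulCommutative_quotient fun x y =>
          IsCyclic.commGroup.mul_comm x y)
  exact ⟨n, le_bot_iff.1 (hn ▸ key n le_rfl)⟩

/-- The endomorphism of the abelianization of an invariant subgroup induced by an endomorphism. -/
def MonoidHom.abelianizationRestrict (a : G →* G) {K : Subgroup G} (hK : K ≤ K.comap a) :
    Module.End ℤ (Additive (Abelianization K)) :=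
  (MonoidHom.toAdditive (Abelianization.map
    ((a.comp K.subtype).codRestrict K fun x => hK x.2))).toIntLinearMap

theorem MonoidHom.abelianizationRestrict_of (a : G →* G) {K : Subgroup G} (hK : K ≤ K.comap a)
    (x : K) : a.abelianizationRestrict hK (Additive.ofMul (Abelianization.of x)) =
      Additive.ofMul (Abelianization.of ⟨a x, hK x.2⟩) := rfl

/-- The map `F` sends every subgroup `K` invariant under `a` to itself, and induces `p(a)` on the
abelianization of `K`. -/
def ActsOnAbelianizationsAs (a : G →* G) (p : ℤ[X]) (F : G → G) : Prop :=
  ∀ (K : Subgroup G) (hK : K ≤ K.comap a) (x : K), ∃ hx : F x ∈ K,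
    Additive.ofMul (Abelianization.of (⟨F x, hx⟩ : K)) =
      aeval (a.abelianizationRestrict hK) p (Additive.ofMul (Abelianization.of x))

namespace ActsOnAbelianizationsAs

variable {a : G →* G} {p q : ℤ[X]} {F F' : G → G}

theorem one (a : G →* G) : ActsOnAbelianizationsAs a 1 id := fun K hK x => ⟨x.2, by simp⟩

theorem X (a : G →* G) : ActsOnAbelianizationsAs a X a :=
  fun K hK x => ⟨hK x.2, by rw [aeval_X, a.abelianizationRestrict_of]⟩

theorem add (h : ActsOnAbelianizationsAs a p F) (h' : ActsOnAbelianizationsAs a q F') :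
    ActsOnAbelianizationsAs a (p + q) (fun x => F x * F' x) := fun K hK x => by
  obtain ⟨h1, h2⟩ := h K hK x
  obtain ⟨h1', h2'⟩ := h' K hK x
  refine ⟨K.mul_mem h1 h1', ?_⟩
  rw [map_add, LinearMap.add_apply, ← h2, ← h2', ← ofMul_mul, ← map_mul]
  rfl

theorem neg (h : ActsOnAbelianizationsAs a p F) :
    ActsOnAbelianizationsAs a (-p) (fun x => (F x)⁻¹) := fun K hK x => by
  obtain ⟨h1, h2⟩ := h K hK x
  refine ⟨K.inv_mem h1, ?_⟩
  rw [map_neg, LinearMap.neg_apply, ← h2, ← ofMul_inv, ← map_inv]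
  rfl

theorem mul (h : ActsOnAbelianizationsAs a p F) (h' : ActsOnAbelianizationsAs a q F') :
    ActsOnAbelianizationsAs a (p * q) (F ∘ F') := fun K hK x => by
  obtain ⟨h1', h2'⟩ := h' K hK x
  obtain ⟨h1, h2⟩ := h K hK ⟨F' x, h1'⟩
  refine ⟨h1, ?_⟩
  rw [map_mul, Module.End.mul_apply, ← h2', ← h2]
  rfl

theorem mem_commutator (h : ActsOnAbelianizationsAs a p F) {K : Subgroup G} (hK : K ≤ K.comap a)
    (hp : aeval (a.abelianizationRestrict hK) p = 0) {x : G} (hx : x ∈ K) : F x ∈ ⁅K, K⁆ := by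
  obtain ⟨h1, h2⟩ := h K hK ⟨x, hx⟩
  rw [hp, LinearMap.zero_apply, ofMul_eq_zero, ← MonoidHom.mem_ker, Abelianization.ker_of] at h2
  rw [← Subgroup.map_subtype_commutator]
  exact Subgroup.mem_map_of_mem K.subtype h2

end ActsOnAbelianizationsAs

theorem exists_monic_aeval_abelianizationRestrict_eq_zero (a : G →* G) {K : Subgroup G}
    (hK : K ≤ K.comap a) (hfg : K.FG) :
    ∃ p : ℤ[X], p.Monic ∧ aeval (a.abelianizationRestrict hK) p = 0 := by
  have : Group.FG K := (Group.fg_iff_subgroup_fg K).2 hfg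
  have : Group.FG (Abelianization K) :=
    Group.fg_of_surjective (f := Abelianization.of) (QuotientGroup.mk'_surjective _)
  have : Module.Finite ℤ (Additive (Abelianization K)) :=
    Module.Finite.iff_addGroup_fg.2 inferInstance
  exact LinearMap.exists_monic_and_aeval_eq_zero ℤ _

end Group

section WordMap

variable {E : Type*} [NormedAddCommGroup E] [NormedSpace ℝ E] {H : Type*} [TopologicalSpace H]
  {I : ModelWithCorners ℝ E H} {G : Type*} [TopologicalSpace G] [ChartedSpace H G] [Group G]

theorem mfderiv_mul_right_eq_self {c : G} (hc : c = 1) (x : G) (v : E) :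
    (mfderiv I I (fun z => z * c) x : E →L[ℝ] E) v = v := by
  have : (fun z : G => z * c) = id := funext fun z => by simp [hc]
  rw [this]
  exact DFunLike.congr_fun (mfderiv_id (I := I) (x := x)) v

theorem mfderiv_mul_left_eq_self {c : G} (hc : c = 1) (x : G) (v : E) :
    (mfderiv I I (fun z => c * z) x : E →L[ℝ] E) v = v := by
  have : (fun z : G => c * z) = id := funext fun z => by simp [hc]
  rw [this]
  exact DFunLike.congr_fun (mfderiv_id (I := I) (x := x)) v

theorem hasMFDerivAt_mul_one [LieGroup I ∞ G] {F F' : G → G} {T T' : E →L[ℝ] E}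
    (h1 : F 1 = 1) (h1' : F' 1 = 1) (hF : HasMFDerivAt I I F 1 T)
    (hF' : HasMFDerivAt I I F' 1 T') :
    HasMFDerivAt I I (fun x => F x * F' x) 1 (T + T' : E →L[ℝ] E) := by
  have hm : MDifferentiableAt (I.prod I) I (fun x : G × G => x.1 * x.2) (F 1, F' 1) :=
    ((contMDiff_mul I ∞).mdifferentiable (by simp)) _
  refine (hm.hasMFDerivAt.comp (f := fun x => (F x, F' x)) 1 (hF.prodMk hF')).congr_mfderiv ?_
  ext v
  exact (mfderiv_prod_eq_add_apply (v := (T v, T' v)) hm).trans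
    (congrArg₂ (fun u w : E => u + w) (mfderiv_mul_right_eq_self h1' _ _)
      (mfderiv_mul_left_eq_self h1 _ _))

/-- `p(a)` is realised by a smooth map of the group, whose derivative at the identity is `p`
evaluated at the derivative of `a`. -/
theorem exists_actsOnAbelianizationsAs [LieGroup I ∞ G] {a : G →* G} (ha : ContMDiff I I ∞ a)
    {D : E →L[ℝ] E} (hD : HasMFDerivAt I I a 1 D) (p : ℤ[X]) :
    ∃ F : G → G, ContMDiff I I ∞ F ∧ F 1 = 1 ∧
      HasMFDerivAt I I F 1 (aeval D p : E →L[ℝ] E) ∧ ActsOnAbelianizationsAs a p F := by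
  let R : Subring ℤ[X] :=
  { carrier := {p | ∃ F : G → G, ContMDiff I I ∞ F ∧ F 1 = 1 ∧
      HasMFDerivAt I I F 1 (aeval D p : E →L[ℝ] E) ∧ ActsOnAbelianizationsAs a p F}
    one_mem' := ⟨id, contMDiff_id, rfl, by rw [map_one]; exact hasMFDerivAt_id 1, .one a⟩
    zero_mem' := ⟨fun _ => 1, contMDiff_const, rfl, by rw [map_zero]; exact hasMFDerivAt_const 1 1,
      fun K hK x => ⟨K.one_mem, by
        rw [map_zero, LinearMap.zero_apply, ofMul_eq_zero]; exact map_one _⟩⟩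
    add_mem' := by
      rintro p q ⟨F, h1, h2, h3, h4⟩ ⟨F', h1', h2', h3', h4'⟩
      exact ⟨_, h1.mul h1', by simp [h2, h2'],
        by rw [map_add]; exact hasMFDerivAt_mul_one h2 h2' h3 h3', h4.add h4'⟩
    mul_mem' := by
      rintro p q ⟨F, h1, h2, h3, h4⟩ ⟨F', h1', h2', h3', h4'⟩
      refine ⟨F ∘ F', h1.comp h1', by simp [h2, h2'], ?_, h4.mul h4'⟩
      rw [map_mul]
      exact HasMFDerivAt.comp 1 (by rwa [h2']) h3'
    neg_mem' := by
      rintro p ⟨F, h1, h2, h3, h4⟩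
      have hd : ContMDiff I I ∞ (fun x => (F x)⁻¹) := h1.inv
      have h2' : (F 1)⁻¹ = 1 := by rw [h2, inv_one]
      refine ⟨_, hd, h2', ?_, h4.neg⟩
      let M : E →L[ℝ] E := mfderiv I I (fun x => (F x)⁻¹) 1
      have hm : HasMFDerivAt I I (fun x => (F x)⁻¹) 1 M :=
        (hd.mdifferentiable (by simp) 1).hasMFDerivAt
      have hs := hasMFDerivAt_mul_one (I := I) h2 h2' h3 hm
      have hc : (fun x => F x * (F x)⁻¹) = fun _ => 1 := funext fun x => mul_inv_cancel _
      rw [hc] at hs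
      have h0 : aeval D p + M = 0 := hasMFDerivAt_unique hs (hasMFDerivAt_const (1 : G) (1 : G))
      rw [map_neg, ← eq_neg_of_add_eq_zero_right h0]
      exact hm }
  have hX : X ∈ R := ⟨a, ha, map_one a, by rwa [aeval_X], .X a⟩
  change p ∈ R
  induction p using Polynomial.induction_on' with
  | add p q hp hq => exact R.add_mem hp hq
  | monomial n c =>
    rw [← C_mul_X_pow_eq_monomial]
    exact R.mul_mem (by simp) (R.pow_mem hX n)

theorem exists_monic_map_derivedSeries [LieGroup I ∞ G] {a : G →* G} (ha : ContMDiff I I ∞ a)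
    {D : E →L[ℝ] E} (hD : HasMFDerivAt I I a 1 D) {Γ : Subgroup G} (hΓ : Γ ≤ Γ.comap a)
    (hfg : ∀ K : Subgroup Γ, K.FG) (n : ℕ) :
    (derivedSeries Γ n).map Γ.subtype ≤ ((derivedSeries Γ n).map Γ.subtype).comap a ∧
    ∃ q : ℤ[X], q.Monic ∧ ∃ F : G → G, ContMDiff I I ∞ F ∧ F 1 = 1 ∧
      HasMFDerivAt I I F 1 (aeval D q : E →L[ℝ] E) ∧
      ∀ x ∈ Γ, F x ∈ (derivedSeries Γ n).map Γ.subtype := by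
  induction n with
  | zero =>
    have h0 : (derivedSeries Γ 0).map Γ.subtype = Γ := by simp [← MonoidHom.range_eq_map]
    rw [h0]
    refine ⟨hΓ, 1, monic_one, id, contMDiff_id, rfl,
      by rw [map_one]; exact hasMFDerivAt_id 1, fun _ hx => hx⟩
  | succ n ih =>
    obtain ⟨hK, q, hq, F, h1, h2, h3, h4⟩ := ih
    set K := (derivedSeries Γ n).map Γ.subtype with hKdef
    have hK' : (derivedSeries Γ (n + 1)).map Γ.subtype = ⁅K, K⁆ := by
      rw [derivedSeries_succ, Subgroup.map_commutator]
    rw [hK']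
    refine ⟨?_, ?_⟩
    · rw [← Subgroup.map_le_iff_le_comap, Subgroup.map_commutator]
      exact Subgroup.commutator_mono (Subgroup.map_le_iff_le_comap.2 hK)
        (Subgroup.map_le_iff_le_comap.2 hK)
    obtain ⟨p, hp, hp0⟩ := exists_monic_aeval_abelianizationRestrict_eq_zero a hK
      ((hfg (derivedSeries Γ n)).subgroupMap _)
    obtain ⟨F', h1', h2', h3', h4'⟩ := exists_actsOnAbelianizationsAs ha hD p
    refine ⟨p * q, hp.mul hq, F' ∘ F, h1'.comp h1, by simp [h2, h2'], ?_,
      fun x hx => h4'.mem_commutator hK hp0 (h4 x hx)⟩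
    rw [map_mul]
    exact HasMFDerivAt.comp 1 (by rwa [h2]) h3

theorem exists_monic_aeval_mfderiv_eq_zero [LieGroup I ∞ G] {a : G →* G} (ha : ContMDiff I I ∞ a)
    {D : E →L[ℝ] E} (hD : HasMFDerivAt I I a 1 D) {Γ : Subgroup G} (hΓ : Γ ≤ Γ.comap a)
    (hdense : Dense (Γ : Set G)) (hpoly : IsPolycyclic Γ) :
    ∃ q : ℤ[X], q.Monic ∧ aeval D q = 0 := by
  obtain ⟨n, hn⟩ := hpoly.isSolvable.solvable
  obtain ⟨-, q, hq, F, h1, h2, h3, h4⟩ :=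
    exists_monic_map_derivedSeries ha hD hΓ hpoly.subgroup_fg n
  have := topologicalGroup_of_lieGroup I ∞ (G := G)
  have := I.t1Space G
  have hF : F = fun _ => 1 := h1.continuous.ext_on hdense continuous_const fun x hx => by
    simpa [hn] using h4 x hx
  subst hF
  exact ⟨q, hq, hasMFDerivAt_unique h3 (hasMFDerivAt_const (I := I) (I' := I) (1 : G) (1 : G))⟩

end WordMap

namespace LieGroupAut

variable {E : Type*} [NormedAddCommGroup E] [NormedSpace ℝ E] {H : Type*} [TopologicalSpace H]
  {I : ModelWithCorners ℝ E H} {G : Type*} [TopologicalSpace G] [ChartedSpace H G] [Group G]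

/-- Evaluation of right invariant vector fields at the identity. -/
def evalOne [LieGroup I ∞ G] : rightInvariantFields I G →ₗ[ℝ] E where
  toFun X := X.1 1
  map_add' _ _ := rfl
  map_smul' _ _ := rfl

theorem evalOne_injective [LieGroup I ∞ G] :
    Function.Injective (evalOne : rightInvariantFields I G →ₗ[ℝ] E) := by
  rw [← LinearMap.ker_eq_bot, LinearMap.ker_eq_bot']
  intro X hX
  refine Subtype.ext (funext fun g => ?_)
  have h := X.2.2 1 g
  have h0 : (X.1 1 : E) = 0 := hX
  have h1 : (X.1 (1 * g) : E) = 0 := by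
    rw [← h]
    exact (congrArg (mfderiv I I (fun x => x * g) 1) h0).trans (map_zero _)
  rw [one_mul] at h1
  exact h1

theorem evalOne_differential [LieGroup I ∞ G] [FiniteDimensional ℝ E] {a : MulAut G}
    (ha : a ∈ lieAut I G) {D : E →L[ℝ] E} (hD : HasMFDerivAt I I (fun x => a x) 1 D)
    (X : rightInvariantFields I G) : evalOne (differential ha X) = D (evalOne X) := by
  have h := (pushforward_eq_iff ha X _).1 rfl 1
  have h1 : mfderiv I I (fun x => a x) 1 = D := hD.mfderiv
  have h2 : ((pushforward ha X).1 (a 1) : E) = (pushforward ha X).1 1 :=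
    congrArg (fun y => ((pushforward ha X).1 y : E)) (map_one a)
  exact h2.symm.trans (h.symm.trans (DFunLike.congr_fun h1 (X.1 1)))

end LieGroupAut

theorem isIntegral_of_hasEigenvalue_baseChange {V : Type*} [AddCommGroup V] [Module ℝ V]
    {f : Module.End ℝ V} {q : ℤ[X]} (hq : q.Monic) (h : aeval f q = 0) {μ : ℂ}
    (hμ : Module.End.HasEigenvalue (LinearMap.baseChange ℂ f) μ) : IsIntegral ℤ μ := by
  refine ⟨q, hq, ?_⟩
  obtain ⟨v, hv⟩ := hμ.exists_hasEigenvector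
  have h1 : aeval (LinearMap.baseChange ℂ f) q = 0 := by
    have := aeval_algHom_apply ((Module.End.baseChangeHom ℝ ℂ V).restrictScalars ℤ) f q
    rw [h, map_zero] at this
    exact this
  have h2 := Module.End.aeval_apply_of_hasEigenvector (p := q.map (algebraMap ℤ ℂ)) hv
  rw [aeval_map_algebraMap, h1, LinearMap.zero_apply, eval_map] at h2
  exact (smul_eq_zero.1 h2.symm).resolve_right hv.2

theorem mainTheorem7 {E : Type*} [NormedAddCommGroup E] [NormedSpace ℝ E] [FiniteDimensional ℝ E]
    {H : Type*} [TopologicalSpace H] (I : ModelWithCorners ℝ E H) [I.Boundaryless]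
    (G : Type*) [TopologicalSpace G] [ChartedSpace H G] [Group G] [LieGroup I ∞ G]
    (Γ : Subgroup G) (hdense : Dense (Γ : Set G)) (hpoly : IsPolycyclic Γ)
    (a : LieGroupAut.lieAutPair I Γ) (μ : ℂ)
    (hμ : Module.End.HasEigenvalue
      ((LieGroupAut.rho Γ a : LieGroupAut.rightInvariantFields I G →ₗ[ℝ]
        LieGroupAut.rightInvariantFields I G).baseChange ℂ) μ) :
    IsIntegral ℤ μ := by
  have ha : ContMDiff I I ∞ (fun x => a.1 x) := a.2.1.1
  let D : E →L[ℝ] E := mfderiv I I (fun x => a.1 x) 1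
  have hD : HasMFDerivAt I I (fun x => a.1 x) 1 D :=
    (ha.mdifferentiable (by simp) 1).hasMFDerivAt
  obtain ⟨q, hq, hq0⟩ := exists_monic_aeval_mfderiv_eq_zero (a := a.1.toMonoidHom) ha hD
    (Subgroup.map_le_iff_le_comap.1 a.2.2.le) hdense hpoly
  let f : Module.End ℝ (LieGroupAut.rightInvariantFields I G) := (LieGroupAut.rho Γ a :
    LieGroupAut.rightInvariantFields I G →ₗ[ℝ] LieGroupAut.rightInvariantFields I G)
  have hf (p : ℤ[X]) (X) : LieGroupAut.evalOne (aeval f p X) =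
      (aeval D p : E →L[ℝ] E) (LieGroupAut.evalOne X) := by
    induction p using Polynomial.induction_on generalizing X with
    | C c => simp
    | add p q hp hq => simp [hp, hq]
    | monomial n c ih =>
      rw [pow_succ, ← mul_assoc, map_mul _ _ Polynomial.X, map_mul _ _ Polynomial.X,
        Module.End.mul_apply, ih, aeval_X, aeval_X]
      exact congrArg _ (LieGroupAut.evalOne_differential a.2.1 hD X)
  refine isIntegral_of_hasEigenvalue_baseChange (f := f) hq ?_ hμ
  refine LinearMap.ext fun X => LieGroupAut.evalOne_injective ?_
  rw [hf, hq0]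
  simp
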